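/- Write points of $\mathbb{R}^{n+m}$ as $\mathbf z=(x,y)$ with $x\in\mathbb{R}^n$, $y\in\mathbb{R}^m$, and use the Euclidean inner product. Let $K\subseteq\mathbb{R}^{n+m}$ be non-empty, closed and convex, with projections $K_x\subseteq\mathbb{R}^n$ and $K_y\subseteq\mathbb{R}^m$, and for $\mathbf z\in K$ let $N_K(\mathbf z)=\{v:\langle v,\mathbf w-\mathbf z\rangle\le 0\ \text{for all }\mathbf w\in K\}$ be the normal cone. Let $\varphi:\mathbb{R}^{n+m}\to\mathbb{R}$ be $C^2$ on an open set containing $K$, and put $\mathbf f(\mathbf z)=(\varphi_x(\mathbf z),-\varphi_y(\mathbf z))$. Assume that $\varphi$ is strictly concave-convex on $K_x\times K_y$ (which is $K$ itself if $K$ is a product): $\varphi(\cdot,y)$ is concave on $K_x$ for every $y\in K_y$, $\varphi(x,\cdot)$ is convex on $K_y$ for every $x\in K_x$, and at least one of the two is strict, that is, $\varphi(\cdot,y)$ is strictly concave for every $y\in K_y$ or $\varphi(x,\cdot)$ is strictly convex for every $x\in K_x$. Assume that $\varphi$ has a $K$-restricted saddle point: a point $\bar{\mathbf z}=(\bar x,\bar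 y)\in K$ such that $\varphi(x,\bar y)\le\varphi(\bar x,\bar y)\le\varphi(\bar x,y)$ for all $x,y$ with $(x,\bar y)\in K$ and $(\bar x,y)\in K$; and, if $K$ is not a product $A\times B$ with $A\subseteq\mathbb{R}^n$, $B\subseteq\mathbb{R}^m$, such that moreover $\mathbf f(\bar{\mathbf z})\in N_K(\bar{\mathbf z})$ (this is automatic if $K$ is a product). Let $\Phi$ be the subgradient method on $K$, that is, a semi-flow on $K$ (a continuous map $\Phi:[0,\infty)\times K\to K$ with $\Phi(0,\mathbf z)=\mathbf z$ and $\Phi(t+s,\mathbf z)=\Phi(t,\Phi(s,\mathbf z))$) whose trajectories are Carathéodory solutions of $$\dot{\mathbf z}=\mathbf f(\mathbf z)-\mathbf P_{N_K(\mathbf z)}(\mathbf f(\mathbf z)),$$ i.e. they are absolutely continuous on bounded time intervals and satisfy the equation at almost every $t\ge 0$; here $\mathbf P_C$ is the nearest-point projection onto $C$. Then the subgradient method on $K$ is globally convergent: for every $\mathbf z\in K$, the distance from $\Phi(t,\mathbf z)$ to the set $\{\mathbf e\in K:\Phi(s,\mathbf e)=\mathbf e\ \text{for all }s\ge 0\}$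 of equilibrium points tends to $0$ as $t\to\infty$ (in particular, this set is not empty). -/

import Mathlib

open scoped NNReal ENNReal Topology
open Filter MeasureTheory

noncomputable section

namespace SaddleDynamics

/-- The Euclidean space `ℝⁿ⁺ᵐ`, with coordinates indexed by `Fin n ⊕ Fin m`. -/
abbrev Pair (n m : ℕ) : Type := EuclideanSpace ℝ (Fin n ⊕ Fin m)

variable {n m : ℕ}

/-- The point `(x, y)` of `ℝⁿ⁺ᵐ`. -/
def pt (x : EuclideanSpace ℝ (Fin n)) (y : EuclideanSpace ℝ (Fin m)) : Pair n m :=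
  WithLp.toLp 2 (Sum.elim x y)

/-- The `x`-component of `z = (x, y)`. -/
def xPart (z : Pair n m) : EuclideanSpace ℝ (Fin n) :=
  WithLp.toLp 2 fun i => z (Sum.inl i)

/-- The `y`-component of `z = (x, y)`. -/
def yPart (z : Pair n m) : EuclideanSpace ℝ (Fin m) :=
  WithLp.toLp 2 fun j => z (Sum.inr j)

/-- The projection of `K` to `ℝⁿ`. -/
def xSet (K : Set (Pair n m)) : Set (EuclideanSpace ℝ (Fin n)) :=
  {x | ∃ y, pt x y ∈ K}

/-- The projection of `K` to `ℝᵐ`. -/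
def ySet (K : Set (Pair n m)) : Set (EuclideanSpace ℝ (Fin m)) :=
  {y | ∃ x, pt x y ∈ K}

/-- `K = A × B` for some `A ⊆ ℝⁿ` and `B ⊆ ℝᵐ`. -/
def IsProductSet (K : Set (Pair n m)) : Prop :=
  ∃ (A : Set (EuclideanSpace ℝ (Fin n))) (B : Set (EuclideanSpace ℝ (Fin m))),
    K = {z | xPart z ∈ A ∧ yPart z ∈ B}

/-- `φ` is concave in `x` and convex in `y` on `xSet K × ySet K`, the smallest product set that
contains `K` (which is `K` itself when `K` is a product). -/
def IsConcaveConvexOn (K : Set (Pair n m)) (φ : Pair n m → ℝ) : Prop :=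
  (∀ y ∈ ySet K, ConcaveOn ℝ (xSet K) (fun x => φ (pt x y))) ∧
    ∀ x ∈ xSet K, ConvexOn ℝ (ySet K) (fun y => φ (pt x y))

/-- `φ` is concave-convex, and at least one of the concavity and the convexity is strict. -/
def IsStrictlyConcaveConvexOn (K : Set (Pair n m)) (φ : Pair n m → ℝ) : Prop :=
  IsConcaveConvexOn K φ ∧
    ((∀ y ∈ ySet K, StrictConcaveOn ℝ (xSet K) (fun x => φ (pt x y))) ∨
      ∀ x ∈ xSet K, StrictConvexOn ℝ (ySet K) (fun y => φ (pt x y)))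

/-- `φ` is twice continuously differentiable on an open set containing `K`. -/
def IsC2On (K : Set (Pair n m)) (φ : Pair n m → ℝ) : Prop :=
  ∃ U : Set (Pair n m), IsOpen U ∧ K ⊆ U ∧ ContDiffOn ℝ 2 φ U

/-- `z = (x̄, ȳ)` is a `K`-restricted saddle point of `φ`. -/
def IsRestrictedSaddlePoint (K : Set (Pair n m)) (φ : Pair n m → ℝ) (z : Pair n m) : Prop :=
  z ∈ K ∧ (∀ x, pt x (yPart z) ∈ K → φ (pt x (yPart z)) ≤ φ z) ∧
    ∀ y, pt (xPart z) y ∈ K → φ z ≤ φ (pt (xPart z) y)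

/-- The normal cone `N_K(z)` (used for `z ∈ K`). -/
def normalCone (K : Set (Pair n m)) (z : Pair n m) : Set (Pair n m) :=
  {v | ∀ w ∈ K, inner ℝ v (w - z) ≤ 0}

/-- The vector field `f = (φ_x, -φ_y)` of the gradient method. -/
def gradField (φ : Pair n m → ℝ) (z : Pair n m) : Pair n m :=
  pt (gradient (fun x => φ (pt x (yPart z))) (xPart z)) (-gradient (fun y => φ (pt (xPart z) y)) (yPart z))

/-- The nearest point to `u` in `C`; it exists and is unique when `C` is non-empty, closed and
convex. -/
def convexProj (C : Set (Pair n m)) (u : Pair n m) : Pair n m :=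
  Classical.epsilon fun p => p ∈ C ∧ ∀ q ∈ C, dist u p ≤ dist u q

theorem convexProj_spec {C : Set (Pair n m)} (hne : C.Nonempty) (hcl : IsClosed C)
    (u : Pair n m) :
    convexProj C u ∈ C ∧ ∀ q ∈ C, dist u (convexProj C u) ≤ dist u q := by
  have h : ∃ p, p ∈ C ∧ ∀ q ∈ C, dist u p ≤ dist u q := by
    obtain ⟨p, hp, hd⟩ := hcl.exists_infDist_eq_dist hne u
    exact ⟨p, hp, fun q hq => hd ▸ Metric.infDist_le_dist_of_mem hq⟩
  exact Classical.epsilon_spec h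

/-- The right-hand side `f(z) - P_{N_K(z)}(f(z))` of the subgradient method. -/
def subgradField (K : Set (Pair n m)) (φ : Pair n m → ℝ) (z : Pair n m) : Pair n m :=
  gradField φ z - convexProj (normalCone K z) (gradField φ z)

/-- `z : [0, ∞) → ℝⁿ⁺ᵐ` is a Carathéodory solution of `ż = g(z)`: it is absolutely continuous
on bounded intervals, and the equation holds at almost every time. -/
def IsCaratheodorySolution (g : Pair n m → Pair n m) (z : ℝ → Pair n m) : Prop :=
  (∀ T : ℝ, 0 ≤ T → AbsolutelyContinuousOnInterval z 0 T) ∧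
    ∀ᵐ t ∂(volume.restrict (Set.Ici (0 : ℝ))), HasDerivAt z (g (z t)) t

/-- The semi-flow `Φ` on `K` is the subgradient method on `K`: its trajectories are
Carathéodory solutions of `ż = f(z) - P_{N_K(z)}(f(z))`. -/
def IsSubgradientMethod (K : Set (Pair n m)) (φ : Pair n m → ℝ) (Φ : Flow ℝ≥0 K) : Prop :=
  ∀ z₀ : K, IsCaratheodorySolution (subgradField K φ)
    (fun t : ℝ => ((Φ t.toNNReal z₀ : K) : Pair n m))

/-- The equilibrium points of a semi-flow. -/
def equilibria {X : Type*} [TopologicalSpace X] (Φ : Flow ℝ≥0 X) : Set X :=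
  {x | ∀ t, Φ t x = x}

/-- Every trajectory converges to the set of equilibrium points. The distance takes values in
`[0, ∞]`, so that the distance to the empty set is `∞`. -/
def GloballyConvergent {X : Type*} [MetricSpace X] (Φ : Flow ℝ≥0 X) : Prop :=
  ∀ x : X, Tendsto (fun t : ℝ≥0 => Metric.infEDist (Φ t x) (equilibria Φ)) atTop (𝓝 0)

end SaddleDynamics

end

/-! This is a LaSalle argument with the squared distance to the saddle point `z` as Lyapunov
function. Concavity-convexity makes `-gradField φ` monotone, and `gradField φ z` lies in the normal
cone, so the distance never increases (`dist_saddle_antitone`). Trajectories are therefore bounded,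
and every limit point starts a trajectory at constant distance from `z`.

Such a trajectory is stationary (`mem_equilibria_of_dist_eq`). Strictness in one variable forces
that component and the value of `φ` to stay equal to those of `z`. Differentiating `φ` then shows
that the velocity is orthogonal to `gradField φ`. Since the velocity is the residual of a projection
onto a cone, its pairing with `gradField φ` is its own squared norm, so it vanishes. -/

open scoped RealInnerProductSpace

/-! ### First-order inequalities for concave and convex functions. -/

section Convexity

variable {E : Type*} [NormedAddCommGroup E] [InnerProductSpace ℝ E] [CompleteSpace E]
  {s : Set E} {f : E → ℝ} {g a b : E}

/-- The gradient inequality for concave functions. -/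
theorem ConcaveOn.le_add_inner_gradient (hf : ConcaveOn ℝ s f) (ha : a ∈ s) (hb : b ∈ s)
    (hg : HasGradientAt f g a) : f b ≤ f a + ⟪g, b - a⟫ := by
  have hc := hf.comp_affineMap (AffineMap.lineMap a b : ℝ →ᵃ[ℝ] E)
  have hd : HasDerivAt (f ∘ (AffineMap.lineMap a b : ℝ →ᵃ[ℝ] E)) ⟪g, b - a⟫ 0 := by
    have h1 : HasFDerivAt f (InnerProductSpace.toDual ℝ E g)
        ((AffineMap.lineMap a b : ℝ →ᵃ[ℝ] E) 0) := by
      simpa using hg.hasFDerivAt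
    simpa using h1.comp_hasDerivAt (0 : ℝ) (AffineMap.hasDerivAt_lineMap (a := a) (b := b))
  have h := hc.slope_le_of_hasDerivAt (x := 0) (y := 1) (by simpa using ha) (by simpa using hb)
    one_pos hd
  simp [slope_def_field] at h
  linarith

/-- Strictness is used at the midpoint of `a` and `b`, where the non-strict gradient inequality then
applies. -/
theorem StrictConcaveOn.lt_add_inner_gradient (hf : StrictConcaveOn ℝ s f) (ha : a ∈ s)
    (hb : b ∈ s) (hab : b ≠ a) (hg : HasGradientAt f g a) : f b < f a + ⟪g, b - a⟫ := by
  have hm := hf.2 ha hb hab.symm (by norm_num : (0 : ℝ) < 1 / 2)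
    (by norm_num : (0 : ℝ) < 1 / 2) (by norm_num)
  have hms := hf.1 ha hb (by norm_num : (0 : ℝ) ≤ 1 / 2)
    (by norm_num : (0 : ℝ) ≤ 1 / 2) (by norm_num)
  have h := hf.concaveOn.le_add_inner_gradient ha hms hg
  have he : (1 / 2 : ℝ) • a + (1 / 2 : ℝ) • b - a = (1 / 2 : ℝ) • (b - a) := by module
  rw [he, inner_smul_right] at h
  simp only [smul_eq_mul] at hm
  linarith

theorem HasGradientAt.neg (hg : HasGradientAt f g a) : HasGradientAt (-f) (-g) a := by
  rw [hasGradientAt_iff_hasFDerivAt] at hg ⊢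
  simpa using HasFDerivAt.neg hg

theorem ConvexOn.add_inner_gradient_le (hf : ConvexOn ℝ s f) (ha : a ∈ s) (hb : b ∈ s)
    (hg : HasGradientAt f g a) : f a + ⟪g, b - a⟫ ≤ f b := by
  have h := hf.neg.le_add_inner_gradient ha hb hg.neg
  simp only [Pi.neg_apply, inner_neg_left] at h
  linarith

theorem StrictConvexOn.add_inner_gradient_lt (hf : StrictConvexOn ℝ s f) (ha : a ∈ s)
    (hb : b ∈ s) (hab : b ≠ a) (hg : HasGradientAt f g a) : f a + ⟪g, b - a⟫ < f b := by
  have h := hf.neg.lt_add_inner_gradient ha hb hab hg.neg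
  simp only [Pi.neg_apply, inner_neg_left] at h
  linarith

/-- The first order condition at a maximum over a convex set. -/
theorem IsMaxOn.inner_gradient_nonpos (hs : Convex ℝ s) (ha : a ∈ s) (hb : b ∈ s)
    (hmax : IsMaxOn f s a) (hg : HasGradientAt f g a) : ⟪g, b - a⟫ ≤ 0 := by
  simpa using hmax.localize.hasFDerivWithinAt_nonpos hg.hasFDerivAt.hasFDerivWithinAt
    (sub_mem_posTangentConeAt_of_segment_subset (hs.segment_subset ha hb))

end Convexity

/-! ### Absolutely continuous functions. -/

section AbsoluteContinuity

theorem AbsolutelyContinuousOnInterval.of_dist_le {X Y : Type*} [PseudoMetricSpace X]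
    [PseudoMetricSpace Y] {f : ℝ → X} {g : ℝ → Y} {a b : ℝ}
    (hf : AbsolutelyContinuousOnInterval f a b) (h : ∀ s t, dist (g s) (g t) ≤ dist (f s) (f t)) :
    AbsolutelyContinuousOnInterval g a b :=
  squeeze_zero (fun _ => Finset.sum_nonneg fun _ _ => dist_nonneg)
    (fun _ => Finset.sum_le_sum fun _ _ => h _ _) hf

theorem AbsolutelyContinuousOnInterval.dist_sq {X : Type*} [PseudoMetricSpace X] {f : ℝ → X}
    {a b : ℝ} (hf : AbsolutelyContinuousOnInterval f a b) (c : X) :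
    AbsolutelyContinuousOnInterval (fun t => dist (f t) c ^ 2) a b := by
  have h : AbsolutelyContinuousOnInterval (fun t => dist (f t) c) a b :=
    hf.of_dist_le fun s t => dist_dist_dist_le_left _ _ _
  simp only [pow_two]
  exact h.mul h

theorem AbsolutelyContinuousOnInterval.le_of_ae_deriv_nonpos {f : ℝ → ℝ} {a b : ℝ} (hab : a ≤ b)
    (hf : AbsolutelyContinuousOnInterval f a b)
    (h : ∀ᵐ t ∂(volume.restrict (Set.Icc a b)), deriv f t ≤ 0) : f b ≤ f a := by
  have h1 := hf.integral_deriv_eq_sub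
  have h2 : ∫ t in a..b, deriv f t ≤ 0 := by
    rw [intervalIntegral.integral_of_le hab]
    exact integral_nonpos_of_ae (ae_restrict_of_ae_restrict_of_subset Set.Ioc_subset_Icc_self h)
  linarith

end AbsoluteContinuity

namespace SaddleDynamics

variable {n m : ℕ} {K : Set (Pair n m)} {φ : Pair n m → ℝ} {z w : Pair n m}

/-! ### Coordinates and partial gradients. -/

@[simp] theorem xPart_pt (x : EuclideanSpace ℝ (Fin n)) (y : EuclideanSpace ℝ (Fin m)) :
    xPart (pt x y) = x := rfl

@[simp] theorem yPart_pt (x : EuclideanSpace ℝ (Fin n)) (y : EuclideanSpace ℝ (Fin m)) :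
    yPart (pt x y) = y := rfl

@[simp] theorem pt_xPart_yPart (z : Pair n m) : pt (xPart z) (yPart z) = z := by
  ext i
  cases i <;> rfl

theorem xPart_sub (z w : Pair n m) : xPart (z - w) = xPart z - xPart w := rfl

theorem yPart_sub (z w : Pair n m) : yPart (z - w) = yPart z - yPart w := rfl

theorem inner_eq_add (z w : Pair n m) :
    ⟪z, w⟫ = ⟪xPart z, xPart w⟫ + ⟪yPart z, yPart w⟫ := by
  simp only [PiLp.inner_apply, Fintype.sum_sum_type]
  rfl

theorem xPart_mem_xSet (hz : z ∈ K) : xPart z ∈ xSet K := ⟨yPart z, by simpa using hz⟩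

theorem yPart_mem_ySet (hz : z ∈ K) : yPart z ∈ ySet K := ⟨xPart z, by simpa using hz⟩

/-- `xPart` as a continuous linear map. -/
noncomputable def xPartL : Pair n m →L[ℝ] EuclideanSpace ℝ (Fin n) :=
  LinearMap.toContinuousLinearMap
    { toFun := xPart
      map_add' := fun _ _ => rfl
      map_smul' := fun _ _ => rfl }

/-- `yPart` as a continuous linear map. -/
noncomputable def yPartL : Pair n m →L[ℝ] EuclideanSpace ℝ (Fin m) :=
  LinearMap.toContinuousLinearMap
    { toFun := yPart
      map_add' := fun _ _ => rfl
      map_smul' := fun _ _ => rfl }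

@[simp] theorem xPartL_apply (z : Pair n m) : xPartL z = xPart z := rfl

@[simp] theorem yPartL_apply (z : Pair n m) : yPartL z = yPart z := rfl

theorem differentiable_pt_left (y : EuclideanSpace ℝ (Fin m)) :
    Differentiable ℝ fun x : EuclideanSpace ℝ (Fin n) => pt x y := by
  rw [differentiable_euclidean]
  rintro (i | j)
  · exact (EuclideanSpace.proj (𝕜 := ℝ) i : EuclideanSpace ℝ (Fin n) →L[ℝ] ℝ).differentiable
  · exact differentiable_const (y j)

theorem differentiable_pt_right (x : EuclideanSpace ℝ (Fin n)) :
    Differentiable ℝ fun y : EuclideanSpace ℝ (Fin m) => pt x y := by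
  rw [differentiable_euclidean]
  rintro (i | j)
  · exact differentiable_const (x i)
  · exact (EuclideanSpace.proj (𝕜 := ℝ) j : EuclideanSpace ℝ (Fin m) →L[ℝ] ℝ).differentiable

theorem IsC2On.differentiableAt (hφ : IsC2On K φ) (hz : z ∈ K) : DifferentiableAt ℝ φ z := by
  obtain ⟨U, hU, hKU, h⟩ := hφ
  exact (h.contDiffAt (hU.mem_nhds (hKU hz))).differentiableAt (by norm_num)

theorem IsC2On.hasGradientAt_left (hφ : IsC2On K φ) (hz : z ∈ K) :
    HasGradientAt (fun x => φ (pt x (yPart z))) (xPart (gradField φ z)) (xPart z) := by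
  have h : DifferentiableAt ℝ φ (pt (xPart z) (yPart z)) := by
    simpa using hφ.differentiableAt hz
  exact (h.comp (xPart z) (differentiable_pt_left (yPart z) (xPart z))).hasGradientAt

theorem IsC2On.hasGradientAt_right (hφ : IsC2On K φ) (hz : z ∈ K) :
    HasGradientAt (fun y => φ (pt (xPart z) y)) (-yPart (gradField φ z)) (yPart z) := by
  have h : DifferentiableAt ℝ φ (pt (xPart z) (yPart z)) := by
    simpa using hφ.differentiableAt hz
  have h' := (h.comp (yPart z) (differentiable_pt_right (xPart z) (yPart z))).hasGradientAt
  rw [gradField, yPart_pt, neg_neg]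
  exact h'

/-! ### Monotonicity and the first-order condition at a saddle point. -/

/-- The inequality behind the monotonicity of the field `-gradField φ`. -/
theorem IsConcaveConvexOn.sub_le_inner_gradField (h : IsConcaveConvexOn K φ) (hφ : IsC2On K φ)
    (hz : z ∈ K) (hw : w ∈ K) :
    φ (pt (xPart w) (yPart z)) - φ (pt (xPart z) (yPart w)) ≤ ⟪gradField φ z, w - z⟫ := by
  have h1 := (h.1 _ (yPart_mem_ySet hz)).le_add_inner_gradient (xPart_mem_xSet hz)
    (xPart_mem_xSet hw) (hφ.hasGradientAt_left hz)
  have h2 := (h.2 _ (xPart_mem_xSet hz)).add_inner_gradient_le (yPart_mem_ySet hz)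
    (yPart_mem_ySet hw) (hφ.hasGradientAt_right hz)
  rw [inner_neg_left] at h2
  rw [inner_eq_add, xPart_sub, yPart_sub]
  linarith

theorem IsConcaveConvexOn.sub_lt_inner_gradField_of_left (h : IsConcaveConvexOn K φ)
    (hs : ∀ y ∈ ySet K, StrictConcaveOn ℝ (xSet K) (fun x => φ (pt x y)))
    (hφ : IsC2On K φ) (hz : z ∈ K) (hw : w ∈ K) (hne : xPart w ≠ xPart z) :
    φ (pt (xPart w) (yPart z)) - φ (pt (xPart z) (yPart w)) < ⟪gradField φ z, w - z⟫ := by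
  have h1 := (hs _ (yPart_mem_ySet hz)).lt_add_inner_gradient (xPart_mem_xSet hz)
    (xPart_mem_xSet hw) hne (hφ.hasGradientAt_left hz)
  have h2 := (h.2 _ (xPart_mem_xSet hz)).add_inner_gradient_le (yPart_mem_ySet hz)
    (yPart_mem_ySet hw) (hφ.hasGradientAt_right hz)
  rw [inner_neg_left] at h2
  rw [inner_eq_add, xPart_sub, yPart_sub]
  linarith

theorem IsConcaveConvexOn.sub_lt_inner_gradField_of_right (h : IsConcaveConvexOn K φ)
    (hs : ∀ x ∈ xSet K, StrictConvexOn ℝ (ySet K) (fun y => φ (pt x y)))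
    (hφ : IsC2On K φ) (hz : z ∈ K) (hw : w ∈ K) (hne : yPart w ≠ yPart z) :
    φ (pt (xPart w) (yPart z)) - φ (pt (xPart z) (yPart w)) < ⟪gradField φ z, w - z⟫ := by
  have h1 := (h.1 _ (yPart_mem_ySet hz)).le_add_inner_gradient (xPart_mem_xSet hz)
    (xPart_mem_xSet hw) (hφ.hasGradientAt_left hz)
  have h2 := (hs _ (xPart_mem_xSet hz)).add_inner_gradient_lt (yPart_mem_ySet hz)
    (yPart_mem_ySet hw) hne (hφ.hasGradientAt_right hz)
  rw [inner_neg_left] at h2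
  rw [inner_eq_add, xPart_sub, yPart_sub]
  linarith

/-- The field of the gradient method is monotone decreasing. -/
theorem IsConcaveConvexOn.inner_gradField_le (h : IsConcaveConvexOn K φ) (hφ : IsC2On K φ)
    (hz : z ∈ K) (hw : w ∈ K) : ⟪gradField φ z, z - w⟫ ≤ ⟪gradField φ w, z - w⟫ := by
  have h1 := h.sub_le_inner_gradField hφ hz hw
  -- Exchanging `z` and `w` flips the sign of the left-hand side, so it cancels in the sum.
  have h2 := h.sub_le_inner_gradField hφ hw hz
  rw [← neg_sub w z, inner_neg_right, inner_neg_right]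
  rw [← neg_sub w z, inner_neg_right] at h2
  linarith

/-- On a product set, a restricted saddle point satisfies the first order condition. -/
theorem IsRestrictedSaddlePoint.gradField_mem_normalCone (hz : IsRestrictedSaddlePoint K φ z)
    (hconv : Convex ℝ K) (hφ : IsC2On K φ) (hK : IsProductSet K) :
    gradField φ z ∈ normalCone K z := by
  intro w hw
  obtain ⟨hzK, hx, hy⟩ := hz
  -- The product structure puts both mixed points in `K`, so the saddle inequalities can be tested
  -- in each variable separately.
  have hmem : pt (xPart w) (yPart z) ∈ K ∧ pt (xPart z) (yPart w) ∈ K := by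
    obtain ⟨A, B, rfl⟩ := hK
    exact ⟨⟨hw.1, hzK.2⟩, ⟨hzK.1, hw.2⟩⟩
  have cx : Convex ℝ {x | pt x (yPart z) ∈ K} := by
    intro a ha b hb s t hs ht hst
    have h := hconv ha hb hs ht hst
    have e : s • pt a (yPart z) + t • pt b (yPart z) = pt (s • a + t • b) (yPart z) := by
      ext (i | j)
      · rfl
      · change s * yPart z j + t * yPart z j = yPart z j
        rw [← add_mul, hst, one_mul]
    rwa [e] at h
  have cy : Convex ℝ {y | pt (xPart z) y ∈ K} := by
    intro a ha b hb s t hs ht hst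
    have h := hconv ha hb hs ht hst
    have e : s • pt (xPart z) a + t • pt (xPart z) b = pt (xPart z) (s • a + t • b) := by
      ext (i | j)
      · change s * xPart z i + t * xPart z i = xPart z i
        rw [← add_mul, hst, one_mul]
      · rfl
    rwa [e] at h
  have h1 : ⟪xPart (gradField φ z), xPart w - xPart z⟫ ≤ 0 :=
    IsMaxOn.inner_gradient_nonpos cx (by simpa using hzK) hmem.1
      (fun x hx' => by simpa using hx x hx') (hφ.hasGradientAt_left hzK)
  have h2 : ⟪- -yPart (gradField φ z), yPart w - yPart z⟫ ≤ 0 :=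
    IsMaxOn.inner_gradient_nonpos cy (by simpa using hzK) hmem.2
      (fun y hy' => by simpa using hy y hy') (hφ.hasGradientAt_right hzK).neg
  rw [neg_neg] at h2
  rw [inner_eq_add, xPart_sub, yPart_sub]
  linarith

/-! ### Projection onto the normal cone. -/

theorem zero_mem_normalCone : (0 : Pair n m) ∈ normalCone K z := fun w _ => by simp

theorem isClosed_normalCone : IsClosed (normalCone K z) := by
  have h : normalCone K z = ⋂ w ∈ K, {v | ⟪v, w - z⟫ ≤ 0} := by
    ext v
    simp [normalCone]
  rw [h]
  exact isClosed_biInter fun w _ => isClosed_le (by fun_prop) continuous_const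

theorem smul_mem_normalCone {v : Pair n m} (hv : v ∈ normalCone K z) {c : ℝ} (hc : 0 ≤ c) :
    c • v ∈ normalCone K z := fun w hw => by
  rw [real_inner_smul_left]
  exact mul_nonpos_of_nonneg_of_nonpos hc (hv w hw)

theorem convexProj_normalCone_mem (u : Pair n m) :
    convexProj (normalCone K z) u ∈ normalCone K z :=
  (convexProj_spec ⟨0, zero_mem_normalCone⟩ isClosed_normalCone u).1

/-- The projection onto the normal cone is orthogonal to its residual. -/
theorem inner_sub_convexProj_normalCone (u : Pair n m) :
    ⟪u - convexProj (normalCone K z) u, convexProj (normalCone K z) u⟫ = 0 := by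
  obtain ⟨hp, hmin⟩ := convexProj_spec ⟨0, zero_mem_normalCone⟩
    (isClosed_normalCone (K := K) (z := z)) u
  set p := convexProj (normalCone K z) u
  -- The cone contains `(1 + s) • p` for `s ≥ -1`; this compares its distance to `u` with that of
  -- `p`.
  have key : ∀ s : ℝ, -1 ≤ s → 2 * s * ⟪u - p, p⟫ ≤ s ^ 2 * ‖p‖ ^ 2 := by
    intro s hs
    have h := hmin _ (smul_mem_normalCone hp (c := 1 + s) (by linarith))
    rw [dist_eq_norm, dist_eq_norm] at h
    have h' := pow_le_pow_left₀ (norm_nonneg _) h 2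
    have e : u - (1 + s) • p = (u - p) - s • p := by module
    rw [e, norm_sub_sq_real (u - p), real_inner_smul_right, norm_smul, mul_pow, Real.norm_eq_abs,
      sq_abs] at h'
    linarith
  by_contra hne
  set a := ⟪u - p, p⟫
  have ha : 0 < |a| := abs_pos.2 hne
  have hb : 0 ≤ ‖p‖ ^ 2 := by positivity
  set b := ‖p‖ ^ 2
  -- This step size is at most `1`, even if `p = 0`, and `s * b ≤ |a|`, whereas `key` at `±s` gives
  -- `2 * |a| ≤ s * b`.
  have hs0 : 0 < |a| / (b + |a|) := by positivity
  have hs1 : |a| / (b + |a|) ≤ 1 := (div_le_one (by positivity)).2 (by linarith)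
  have hmul : |a| / (b + |a|) * (b + |a|) = |a| := div_mul_cancel₀ _ (by positivity)
  set s := |a| / (b + |a|)
  have h1 := key s (by linarith)
  have h2 := key (-s) (by linarith)
  have h3 : s * (2 * |a|) ≤ s * (s * b) := by
    rcases abs_cases a with ⟨h, _⟩ | ⟨h, _⟩ <;> rw [h] <;> nlinarith
  have h4 := le_of_mul_le_mul_left h3 hs0
  nlinarith

/-- The subtracted vector is normal to `K` at `z`, so removing it cannot slow the approach to a
point of `K`. -/
theorem inner_subgradField_le (hw : w ∈ K) :
    ⟪subgradField K φ z, z - w⟫ ≤ ⟪gradField φ z, z - w⟫ := by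
  have h := convexProj_normalCone_mem (K := K) (z := z) (gradField φ z) w hw
  rw [← neg_sub z w, inner_neg_right] at h
  rw [subgradField, inner_sub_left]
  linarith

theorem subgradField_eq_zero (h : ⟪gradField φ z, subgradField K φ z⟫ = 0) :
    subgradField K φ z = 0 := by
  have h1 := inner_sub_convexProj_normalCone (K := K) (z := z) (gradField φ z)
  rw [real_inner_comm] at h1
  rw [← inner_self_eq_zero (𝕜 := ℝ)]
  nth_rewrite 1 [subgradField]
  rw [inner_sub_left, h]
  simpa [subgradField] using h1

/-- If the field does not point strictly towards the saddle point, and the concavity is strict,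
then the `x`-component and the value of `φ` are those of the saddle point. -/
theorem IsRestrictedSaddlePoint.eq_of_inner_nonpos_left (hz : IsRestrictedSaddlePoint K φ z)
    (hN : gradField φ z ∈ normalCone K z) (h : IsConcaveConvexOn K φ) (hφ : IsC2On K φ)
    (hs : ∀ y ∈ ySet K, StrictConcaveOn ℝ (xSet K) (fun x => φ (pt x y)))
    (hw : w ∈ K) (hle : ⟪gradField φ w, z - w⟫ ≤ 0) : xPart w = xPart z ∧ φ w = φ z := by
  have h1 := h.sub_le_inner_gradField hφ hw hz.1
  have h3 := hN w hw
  -- Otherwise the values of `φ` at the two mixed points would compare strictly one way by `h2` and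
  -- the other way by `h1`.
  have hx : xPart w = xPart z := by
    by_contra hne
    have h2 := h.sub_lt_inner_gradField_of_left hs hφ hz.1 hw hne
    linarith
  refine ⟨hx, le_antisymm ?_ ?_⟩
  -- With equal `x`-parts the mixed points are `w` and `z` themselves.
  · rw [← hx, pt_xPart_yPart, hx, pt_xPart_yPart] at h1
    linarith
  · have h2 := hz.2.2 (yPart w)
    rw [← hx, pt_xPart_yPart] at h2
    exact h2 hw

theorem IsRestrictedSaddlePoint.eq_of_inner_nonpos_right (hz : IsRestrictedSaddlePoint K φ z)
    (hN : gradField φ z ∈ normalCone K z) (h : IsConcaveConvexOn K φ) (hφ : IsC2On K φ)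
    (hs : ∀ x ∈ xSet K, StrictConvexOn ℝ (ySet K) (fun y => φ (pt x y)))
    (hw : w ∈ K) (hle : ⟪gradField φ w, z - w⟫ ≤ 0) : yPart w = yPart z ∧ φ w = φ z := by
  have h1 := h.sub_le_inner_gradField hφ hw hz.1
  have h3 := hN w hw
  have hy : yPart w = yPart z := by
    by_contra hne
    have h2 := h.sub_lt_inner_gradField_of_right hs hφ hz.1 hw hne
    linarith
  refine ⟨hy, le_antisymm ?_ ?_⟩
  · have h2 := hz.2.1 (xPart w)
    rw [← hy, pt_xPart_yPart] at h2
    exact h2 hw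
  · rw [← hy, pt_xPart_yPart, hy, pt_xPart_yPart] at h1
    linarith

/-! ### Distance to the saddle point along trajectories. -/

theorem hasDerivAt_dist_sq {u : ℝ → Pair n m} {v : Pair n m} {t : ℝ} (hu : HasDerivAt u v t)
    (c : Pair n m) : HasDerivAt (fun s => dist (u s) c ^ 2) (2 * ⟪v, u t - c⟫) t := by
  have h := (hu.sub_const c).norm_sq
  simp only [dist_eq_norm]
  rwa [real_inner_comm] at h

variable {Φ : Flow ℝ≥0 K}

theorem continuous_trajectory (Φ : Flow ℝ≥0 K) (e : K) :
    Continuous fun t : ℝ => ((Φ t.toNNReal e : K) : Pair n m) :=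
  continuous_subtype_val.comp (Φ.continuous continuous_real_toNNReal continuous_const)

theorem IsSubgradientMethod.ae_hasDerivAt (hΦ : IsSubgradientMethod K φ Φ) (e : K) :
    ∀ᵐ t ∂(volume.restrict (Set.Ioi (0 : ℝ))),
      HasDerivAt (fun t : ℝ => ((Φ t.toNNReal e : K) : Pair n m))
        (subgradField K φ (Φ t.toNNReal e : K)) t :=
  ae_restrict_of_ae_restrict_of_subset Set.Ioi_subset_Ici_self (hΦ e).2

/-- The distance to a saddle point does not increase along trajectories. -/
theorem IsSubgradientMethod.dist_saddle_antitone (hΦ : IsSubgradientMethod K φ Φ)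
    (h : IsConcaveConvexOn K φ) (hφ : IsC2On K φ) (hz : z ∈ K)
    (hN : gradField φ z ∈ normalCone K z) (e : K) :
    Antitone fun t : ℝ≥0 => dist ((Φ t e : K) : Pair n m) z := by
  intro a b hab
  have hab' : (a : ℝ) ≤ b := hab
  have hac := (((hΦ e).1 b b.2).mono (c := a) (d := b) (by
    rw [Set.uIcc_of_le hab', Set.uIcc_of_le b.coe_nonneg]
    exact Set.Icc_subset_Icc_left a.coe_nonneg)).dist_sq z
  have hle := hac.le_of_ae_deriv_nonpos hab' (by
    have hsub : Set.Icc (a : ℝ) b ⊆ Set.Ici 0 := fun t ht => a.2.trans ht.1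
    filter_upwards [ae_restrict_of_ae_restrict_of_subset hsub (hΦ e).2] with t ht
    rw [(hasDerivAt_dist_sq ht z).deriv]
    have hK := (Φ t.toNNReal e : K).2
    have h1 := inner_subgradField_le (φ := φ) (z := (Φ t.toNNReal e : K)) hz
    have h2 := h.inner_gradField_le hφ hK hz
    have h3 := hN _ hK
    linarith)
  simp only [Real.toNNReal_coe] at hle
  exact le_of_sq_le_sq hle dist_nonneg

/-- A trajectory with almost everywhere vanishing velocity is an equilibrium point. -/
theorem IsSubgradientMethod.mem_equilibria (hΦ : IsSubgradientMethod K φ Φ) (e : K)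
    (h : ∀ᵐ t ∂(volume.restrict (Set.Ioi (0 : ℝ))), subgradField K φ (Φ t.toNNReal e : K) = 0) :
    e ∈ equilibria Φ := by
  intro t
  have h0 : ∀ᵐ s ∂(volume.restrict (Set.Ici (0 : ℝ))),
      HasDerivAt (fun t : ℝ => ((Φ t.toNNReal e : K) : Pair n m)) 0 s := by
    rw [← restrict_Ioi_eq_restrict_Ici]
    filter_upwards [h, hΦ.ae_hasDerivAt e] with s h1 h2
    rwa [h1] at h2
  rw [ae_restrict_iff' measurableSet_Ici] at h0
  obtain ⟨C, hC⟩ := ((hΦ e).1 t t.2).const_of_ae_hasDerivAt_zero (by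
    filter_upwards [h0] with s hs hst
    rw [Set.uIcc_of_le t.coe_nonneg] at hst
    exact hs hst.1)
  have h1 := hC t Set.right_mem_uIcc
  have h2 := hC 0 Set.left_mem_uIcc
  simp only [Real.toNNReal_coe, Real.toNNReal_zero, Φ.map_zero_apply] at h1 h2
  exact Subtype.ext (h1.trans h2.symm)

theorem continuous_comp_trajectory (hφ : IsC2On K φ) (Φ : Flow ℝ≥0 K) (e : K) :
    Continuous fun t : ℝ => φ (Φ t.toNNReal e : K) := by
  obtain ⟨U, -, hKU, h⟩ := hφ
  exact h.continuousOn.comp_continuous (continuous_trajectory Φ e)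
    fun t => hKU (Φ t.toNNReal e).2

/-- A trajectory that keeps its distance from a saddle point is stationary. -/
theorem IsSubgradientMethod.mem_equilibria_of_dist_eq (hΦ : IsSubgradientMethod K φ Φ)
    (h : IsStrictlyConcaveConvexOn K φ) (hφ : IsC2On K φ) (hz : IsRestrictedSaddlePoint K φ z)
    (hN : gradField φ z ∈ normalCone K z) (e : K) (d : ℝ)
    (hd : ∀ t : ℝ≥0, dist ((Φ t e : K) : Pair n m) z = d) : e ∈ equilibria Φ := by
  have hu := continuous_trajectory Φ e
  have hφu := continuous_comp_trajectory hφ Φ e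
  have hle : ∀ᵐ t ∂(volume.restrict (Set.Ioi (0 : ℝ))),
      ⟪gradField φ (Φ t.toNNReal e : K), z - (Φ t.toNNReal e : K)⟫ ≤ 0 := by
    filter_upwards [hΦ.ae_hasDerivAt e] with t ht
    have h1 := hasDerivAt_dist_sq ht z
    simp only [hd] at h1
    have h2 := (hasDerivAt_const t (d ^ 2)).unique h1
    have h3 := inner_subgradField_le (φ := φ) (z := (Φ t.toNNReal e : K)) hz.1
    rw [← neg_sub, inner_neg_right]
    linarith
  refine hΦ.mem_equilibria e ?_
  rcases h with ⟨hcc, hs | hs⟩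
  · have hae := hle.mono fun t ht =>
      hz.eq_of_inner_nonpos_left hN hcc hφ hs (Φ t.toNNReal e).2 ht
    -- Continuity upgrades the almost everywhere identities to all positive times, so that they can
    -- be differentiated.
    have hx : Set.EqOn (fun t : ℝ => xPart ((Φ t.toNNReal e : K) : Pair n m)) (fun _ => xPart z)
        (Set.Ioi 0) :=
      Measure.eqOn_open_of_ae_eq (hae.mono fun _ ht => ht.1) isOpen_Ioi
        (xPartL.continuous.comp hu).continuousOn continuousOn_const
    have hv : Set.EqOn (fun t : ℝ => φ (Φ t.toNNReal e : K)) (fun _ => φ z) (Set.Ioi 0) :=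
      Measure.eqOn_open_of_ae_eq (hae.mono fun _ ht => ht.2) isOpen_Ioi
        hφu.continuousOn continuousOn_const
    filter_upwards [hΦ.ae_hasDerivAt e, ae_restrict_mem measurableSet_Ioi] with t ht ht0
    have hnhds : Set.Ioi (0 : ℝ) ∈ 𝓝 t := Ioi_mem_nhds ht0
    have hdx : xPart (subgradField K φ (Φ t.toNNReal e : K)) = 0 :=
      (xPartL.hasFDerivAt.comp_hasDerivAt t ht).unique
        ((hasDerivAt_const t (xPart z)).congr_of_eventuallyEq (hx.eventuallyEq_of_mem hnhds))
    -- The `x`-part is constant near `t`, so `φ` along the trajectory is a function of the `y`-part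
    -- alone.
    have hg := (hφ.hasGradientAt_right (Φ t.toNNReal e).2).hasFDerivAt.comp_hasDerivAt t
      (yPartL.hasFDerivAt.comp_hasDerivAt t ht)
    have hdy := hg.unique ((hasDerivAt_const t (φ z)).congr_of_eventuallyEq (by
      filter_upwards [hnhds] with s hs0
      have e1 := (hx ht0).trans (hx hs0).symm
      dsimp only at e1
      simpa [e1] using hv hs0))
    refine subgradField_eq_zero ?_
    rw [inner_eq_add, hdx, inner_zero_right, zero_add]
    simpa using hdy
  · have hae := hle.mono fun t ht =>
      hz.eq_of_inner_nonpos_right hN hcc hφ hs (Φ t.toNNReal e).2 ht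
    have hy : Set.EqOn (fun t : ℝ => yPart ((Φ t.toNNReal e : K) : Pair n m)) (fun _ => yPart z)
        (Set.Ioi 0) :=
      Measure.eqOn_open_of_ae_eq (hae.mono fun _ ht => ht.1) isOpen_Ioi
        (yPartL.continuous.comp hu).continuousOn continuousOn_const
    have hv : Set.EqOn (fun t : ℝ => φ (Φ t.toNNReal e : K)) (fun _ => φ z) (Set.Ioi 0) :=
      Measure.eqOn_open_of_ae_eq (hae.mono fun _ ht => ht.2) isOpen_Ioi
        hφu.continuousOn continuousOn_const
    filter_upwards [hΦ.ae_hasDerivAt e, ae_restrict_mem measurableSet_Ioi] with t ht ht0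
    have hnhds : Set.Ioi (0 : ℝ) ∈ 𝓝 t := Ioi_mem_nhds ht0
    have hdy : yPart (subgradField K φ (Φ t.toNNReal e : K)) = 0 :=
      (yPartL.hasFDerivAt.comp_hasDerivAt t ht).unique
        ((hasDerivAt_const t (yPart z)).congr_of_eventuallyEq (hy.eventuallyEq_of_mem hnhds))
    have hg := (hφ.hasGradientAt_left (Φ t.toNNReal e).2).hasFDerivAt.comp_hasDerivAt t
      (xPartL.hasFDerivAt.comp_hasDerivAt t ht)
    have hdx := hg.unique ((hasDerivAt_const t (φ z)).congr_of_eventuallyEq (by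
      filter_upwards [hnhds] with s hs0
      have e1 := (hy ht0).trans (hy hs0).symm
      dsimp only at e1
      simpa [e1] using hv hs0))
    refine subgradField_eq_zero ?_
    rw [inner_eq_add, hdy, inner_zero_right, add_zero]
    simpa using hdx

end SaddleDynamics

/-! ### The LaSalle argument. -/

/-- A semi-flow is globally convergent if the distance to some point is non-increasing along
trajectories in a proper space, and constant only along stationary trajectories. -/
theorem SaddleDynamics.globallyConvergent_of_antitone_dist {X : Type*} [MetricSpace X]
    [ProperSpace X] (Φ : Flow ℝ≥0 X) (c : X) (hanti : ∀ x, Antitone fun t => dist (Φ t x) c)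
    (heq : ∀ x d, (∀ t, dist (Φ t x) c = d) → x ∈ SaddleDynamics.equilibria Φ) :
    SaddleDynamics.GloballyConvergent Φ := by
  intro x
  obtain ⟨d, hd⟩ : ∃ d, Tendsto (fun t => dist (Φ t x) c) atTop (𝓝 d) :=
    ⟨_, tendsto_atTop_ciInf (hanti x) ⟨0, by rintro _ ⟨t, rfl⟩; exact dist_nonneg⟩⟩
  rw [ENNReal.tendsto_nhds_zero]
  intro ε hε
  by_contra hfr
  -- This also covers an empty set of equilibria, where the distance is `∞`: the limit point found
  -- below is an equilibrium.
  have hfr' : ∃ᶠ t in atTop, ε < Metric.infEDist (Φ t x) (SaddleDynamics.equilibria Φ) := by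
    simpa only [not_eventually, not_le] using hfr
  obtain ⟨t, ht, htε⟩ := exists_seq_forall_of_frequently hfr'
  obtain ⟨e, -, k, hk, hlim⟩ := (isCompact_closedBall c (dist (Φ 0 x) c)).tendsto_subseq
    (x := fun i => Φ (t i) x) fun i => hanti x zero_le
  have htk : Tendsto (fun i => t (k i)) atTop atTop := ht.comp hk.tendsto_atTop
  -- At times `s + t (k i)` the distance to `c` tends both to `d` and to that of `Φ s e`.
  have he : e ∈ SaddleDynamics.equilibria Φ := by
    refine heq e d fun s => ?_
    have h1 : Tendsto (fun i => dist (Φ s (Φ (t (k i)) x)) c) atTop (𝓝 (dist (Φ s e) c)) :=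
      (((Φ.continuous_toFun s).tendsto e).comp hlim).dist tendsto_const_nhds
    have h2 := hd.comp (tendsto_atTop_mono (fun i => (le_add_self : t (k i) ≤ s + t (k i))) htk)
    simp only [Function.comp_def, fun i => Φ.map_add s (t (k i)) x] at h2
    exact tendsto_nhds_unique h1 h2
  have h3 : Tendsto (fun i => Metric.infEDist (Φ (t (k i)) x) (SaddleDynamics.equilibria Φ)) atTop
      (𝓝 (Metric.infEDist e (SaddleDynamics.equilibria Φ))) :=
    (Metric.continuous_infEDist.tendsto e).comp hlim
  have h4 := ge_of_tendsto' h3 fun i => (htε (k i)).le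
  rw [Metric.infEDist_zero_of_mem he] at h4
  exact absurd h4 (not_le.2 hε)

theorem mainTheorem6 (n m : ℕ)
    (K : Set (SaddleDynamics.Pair n m)) (hne : K.Nonempty) (hcl : IsClosed K)
    (hconv : Convex ℝ K)
    (φ : SaddleDynamics.Pair n m → ℝ) (hφ : SaddleDynamics.IsC2On K φ)
    (hstrict : SaddleDynamics.IsStrictlyConcaveConvexOn K φ)
    (hsaddle : ∃ z, SaddleDynamics.IsRestrictedSaddlePoint K φ z ∧
      (¬ SaddleDynamics.IsProductSet K →
        SaddleDynamics.gradField φ z ∈ SaddleDynamics.normalCone K z))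
    (Φ : Flow ℝ≥0 K) (hΦ : SaddleDynamics.IsSubgradientMethod K φ Φ) :
    SaddleDynamics.GloballyConvergent Φ := by
  obtain ⟨z, hz, hzN⟩ := hsaddle
  have hN : SaddleDynamics.gradField φ z ∈ SaddleDynamics.normalCone K z := by
    by_cases hK : SaddleDynamics.IsProductSet K
    · exact hz.gradField_mem_normalCone hconv hφ hK
    · exact hzN hK
  have : ProperSpace K :=
    LipschitzWith.properSpace hcl.isClosedEmbedding_subtypeVal.isProperMap
      (LipschitzWith.subtype_val K)
  exact SaddleDynamics.globallyConvergent_of_antitone_dist Φ ⟨z, hz.1⟩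
    (fun e => hΦ.dist_saddle_antitone hstrict.1 hφ hz.1 hN e)
    fun e d hd => hΦ.mem_equilibria_of_dist_eq hstrict hφ hz hN e d hd
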